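/- Let $\mathbb{H}$ denote the real quaternions and $U(\mathbb{H})=\{q\in\mathbb{H}:|q|=1\}$. A quaternion unit gain graph $\widetilde G=(G,U(\mathbb{H}),\varphi)$ consists of a finite simple graph $G$ and a function $\varphi$ assigning to each oriented edge $e_{uv}$ of $G$ an element of $U(\mathbb{H})$ such that $\varphi(e_{vu})=\varphi(e_{uv})^{-1}$. Its adjacency matrix $A(\widetilde G)$ is the quaternion matrix indexed by the vertices whose $(u,v)$ entry is $\varphi(e_{uv})$ if $u$ and $v$ are adjacent and $0$ otherwise. Let $r(\widetilde G)$ be the row left rank of $A(\widetilde G)$, i.e. the maximum number of rows of $A(\widetilde G)$ that are left linearly independent over $\mathbb{H}$. Let $p(\widetilde G)$ be the number of pendant vertices (vertices of degree $1$) of $G$, and let $c(\widetilde G)=|E(G)|-|V(G)|+\omega(G)$ be the cyclomatic number, where $\omega(G)$ is the number of connected components of $G$. Call $\widetilde G$ cycle-disjoint if no two distinct cycles of $G$ have a common vertex. **Theorem.** Let $\widetilde G$ be a quaternion unit gain graph of order $n=|V(G)|$ (not necessarily connected) in which every connected component has at least two vertices. Then $$ r(\widetilde G)\ \ge\ \begin{cases}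 n-2c(\widetilde G)-p(\widetilde G)+1, & \text{if } p(\widetilde G)\ge 1;\\ n-2c(\widetilde G), & \text{if } p(\widetilde G)=0 \text{ and } \widetilde G \text{ is cycle-disjoint};\\ n-2c(\widetilde G)+1, & \text{if } p(\widetilde G)=0 \text{ and some two distinct cycles of } G \text{ have a common vertex}. \end{cases} $$ -/

import Mathlib

open scoped Quaternion

/-- A quaternion unit gain graph on the vertex set `V`: a simple underlying graph, together with a
gain function from its oriented edges (darts) to the group `U(ℍ) = {q : ‖q‖ = 1}` such that the gain
of the reversed edge is the inverse of the gain of the edge. -/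
structure QuaternionUnitGainGraph (V : Type*) where
  /-- the underlying graph -/
  graph : SimpleGraph V
  /-- the gain of an oriented edge -/
  gain : graph.Dart → Metric.sphere (0 : ℍ[ℝ]) 1
  gain_symm : ∀ e : graph.Dart, gain e.symm = (gain e)⁻¹

/-- The row left rank of a quaternion matrix: the maximal number of rows which are left linearly
independent (the scalars of `ℍ[ℝ]` act on `n → ℍ[ℝ]` by multiplication from the left). -/
noncomputable def Matrix.rowLeftRank {m n : Type*} [Fintype m] (A : Matrix m n ℍ[ℝ]) : ℕ :=
  open Classical in
  (Finset.univ.filter fun s : Finset m =>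
    LinearIndependent ℍ[ℝ] (fun i : s => (A.row i : n → ℍ[ℝ]))).sup Finset.card

namespace SimpleGraph

variable {V : Type*} (G : SimpleGraph V)

/-- A subgraph which is a cycle. -/
def IsCycleSubgraph {G : SimpleGraph V} (C : G.Subgraph) : Prop :=
  ∃ (v : V) (w : G.Walk v v), w.IsCycle ∧ w.toSubgraph = C

/-- Distinct cycles of `G` have no common vertex. -/
def CycleDisjoint : Prop :=
  ∀ C D : G.Subgraph, IsCycleSubgraph C → IsCycleSubgraph D → C ≠ D → Disjoint C.verts D.verts

/-- Some two distinct cycles of `G` have a common vertex. -/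
def HasCyclesWithCommonVertex : Prop :=
  ∃ C D : G.Subgraph, IsCycleSubgraph C ∧ IsCycleSubgraph D ∧ C ≠ D ∧ (C.verts ∩ D.verts).Nonempty

end SimpleGraph

namespace QuaternionUnitGainGraph

variable {V : Type*} (Γ : QuaternionUnitGainGraph V)

/-- The adjacency matrix: the entry at `(u, v)` is the gain of the oriented edge from `u` to `v`,
and `0` if there is no such edge. -/
noncomputable def adjacencyMatrix : Matrix V V ℍ[ℝ] :=
  open Classical in
  Matrix.of fun u v => if h : Γ.graph.Adj u v then (Γ.gain ⟨(u, v), h⟩ : ℍ[ℝ]) else 0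

/-- The rank of a gain graph: the row left rank of its adjacency matrix. -/
noncomputable def rank [Fintype V] : ℕ := Γ.adjacencyMatrix.rowLeftRank

/-- The number of pendant vertices (vertices with exactly one neighbour). -/
noncomputable def pendantNumber : ℕ := {v : V | (Γ.graph.neighborSet v).ncard = 1}.ncard

/-- The cyclomatic number: number of edges, minus number of vertices, plus number of connected
components. -/
noncomputable def cyclomaticNumber : ℤ :=
  (Γ.graph.edgeSet.ncard : ℤ) - (Nat.card V : ℤ) + (Nat.card Γ.graph.ConnectedComponent : ℤ)

end QuaternionUnitGainGraph

/-! Order the vertices and let `m w` be the first neighbour of `w`. Picking for each `v` in the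
image of `m` a column `w` with `m w = v` gives a triangular pattern, so the rank is at least the
size of the image, whatever the gains.

Take an order in which only the chosen root of each component lacks an earlier neighbour. The edges
from non-roots `w` to `m w` form a spanning forest, and the excesses (degree minus forest degree)
sum to `2c`. A vertex outside the image is a non-root leaf of the forest, so it has positive excess
unless it is pendant. Hence at most `2c` plus the number of non-root pendants are missed.

The extra `1` comes from rooting at a pendant vertex or, when cycles meet, from a vertex of degree
at least three with a non-forest edge, whose excess is not used up. -/

theorem Matrix.le_rowLeftRank_of_triangular {m n : Type*} [Fintype m] (A : Matrix m n ℍ[ℝ])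
    (s : Finset m) (π : m → ℕ) (hπ : Function.Injective π) (c : m → n)
    (hne : ∀ i ∈ s, A i (c i) ≠ 0)
    (hzero : ∀ i ∈ s, ∀ j ∈ s, π j < π i → A j (c i) = 0) :
    s.card ≤ A.rowLeftRank := by
  classical
  have hli : LinearIndependent ℍ[ℝ] (fun i : s => (A.row i : n → ℍ[ℝ])) := by
    rw [Fintype.linearIndependent_iff]
    intro g hg
    by_contra! hcon
    obtain ⟨i₀, hi₀⟩ := hcon
    -- In column `c j` for the latest row `j` with nonzero coefficient, earlier rows vanish and
    -- later rows have coefficient zero.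
    obtain ⟨j, hj, hmax⟩ := Finset.exists_max_image (Finset.univ.filter fun i : s => g i ≠ 0)
      (fun i => π i) ⟨i₀, by simpa using hi₀⟩
    have hgj : g j ≠ 0 := by simpa using hj
    have hcol := congrFun hg (c j)
    rw [Finset.sum_apply, Finset.sum_eq_single j] at hcol
    · exact mul_ne_zero hgj (hne j j.2) hcol
    · intro i _ hij
      change g i * A i (c j) = 0
      by_cases hgi : g i = 0
      · rw [hgi, zero_mul]
      · have hle := hmax i (by simpa using hgi)
        have hlt : π i < π j :=
          lt_of_le_of_ne hle fun h => hij (Subtype.ext (hπ h))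
        rw [hzero j j.2 i i.2 hlt, mul_zero]
    · simp
  unfold Matrix.rowLeftRank
  refine Finset.le_sup (f := Finset.card) (b := s) ?_
  rw [Finset.mem_filter]
  exact ⟨Finset.mem_univ _, hli⟩

/-- Every value of a function sending each vertex to its first neighbour, for some ordering of the
vertices, contributes to the rank. -/
theorem QuaternionUnitGainGraph.card_image_firstNeighbor_le_rank {V : Type*} [Fintype V]
    [DecidableEq V] (Γ : QuaternionUnitGainGraph V) (π : V → ℕ) (hπ : Function.Injective π)
    (m : V → V) (hadj : ∀ w, Γ.graph.Adj w (m w))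
    (hmin : ∀ w u, Γ.graph.Adj w u → π (m w) ≤ π u) :
    (Finset.univ.image m).card ≤ Γ.rank := by
  classical
  have hch : ∀ v : V, ∃ w, v ∈ Finset.univ.image m → m w = v := by
    intro v
    by_cases h : v ∈ Finset.univ.image m
    · obtain ⟨w, -, hw⟩ := Finset.mem_image.1 h
      exact ⟨w, fun _ => hw⟩
    · exact ⟨v, fun h' => absurd h' h⟩
  choose c hc using hch
  refine Matrix.le_rowLeftRank_of_triangular _ _ π hπ c ?_ ?_
  · intro i hi
    have h : Γ.graph.Adj i (c i) := by
      have := hadj (c i)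
      rw [hc i hi] at this
      exact this.symm
    simp only [QuaternionUnitGainGraph.adjacencyMatrix, Matrix.of_apply, dif_pos h]
    exact ne_zero_of_mem_unit_sphere _
  · intro i hi j _ hji
    have h : ¬ Γ.graph.Adj j (c i) := fun h => by
      have := hmin (c i) j h.symm
      rw [hc i hi] at this
      omega
    simp only [QuaternionUnitGainGraph.adjacencyMatrix, Matrix.of_apply, dif_neg h]

/-! ### Vertex orders, roots and first neighbours -/

namespace SimpleGraph

variable {V : Type*} (G : SimpleGraph V)

theorem Reachable.exists_adj_dist_lt {G : SimpleGraph V} {a w : V} (h : G.Reachable a w)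
    (hne : w ≠ a) : ∃ u, G.Adj u w ∧ G.Reachable a u ∧ G.dist a u < G.dist a w := by
  obtain ⟨p, hp⟩ := h.symm.exists_walk_length_eq_dist
  cases p with
  | nil => exact absurd rfl hne
  | @cons _ u _ hadj q =>
    refine ⟨u, hadj.symm, q.reverse.reachable, ?_⟩
    have := dist_le q
    rw [Walk.length_cons] at hp
    rw [dist_comm, dist_comm (u := a)]
    omega

theorem exists_injective_refining [Fintype V] (key : V → ℕ) :
    ∃ π : V → ℕ, Function.Injective π ∧ ∀ u v, key u < key v → π u < π v := by
  let e := Fintype.equivFin V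
  -- Lexicographic order: ties in `key` are broken by the index `e v`, which is below `card V`.
  refine ⟨fun v => key v * Fintype.card V + e v, ?_, ?_⟩
  · intro u v h
    have hu := (e u).2
    have hv := (e v).2
    have hkey : key u = key v := by
      by_contra hne
      rcases lt_or_gt_of_ne hne with hlt | hlt <;>
      · have := Nat.mul_le_mul_right (Fintype.card V) hlt
        simp only at h
        rw [Nat.succ_mul] at this
        omega
    simp only [hkey] at h
    exact e.injective (Fin.ext (by omega))
  · intro u v hlt
    have hu := (e u).2
    have := Nat.mul_le_mul_right (Fintype.card V) hlt
    rw [Nat.succ_mul] at this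
    simp only
    omega

theorem exists_root_through (v₀ : V) : ∃ ρ : G.ConnectedComponent → V,
    (∀ K, G.connectedComponentMk (ρ K) = K) ∧ ρ (G.connectedComponentMk v₀) = v₀ := by
  classical
  refine ⟨Function.update (fun K : G.ConnectedComponent => K.out) (G.connectedComponentMk v₀) v₀, fun K => ?_, by simp⟩
  by_cases h : K = G.connectedComponentMk v₀
  · subst h
    simp
  · rw [Function.update_of_ne h]
    exact Quot.out_eq K

theorem exists_adj_of_two_le_ncard_supp (hcomp : ∀ K : G.ConnectedComponent, 2 ≤ K.supp.ncard)
    (v : V) : ∃ u, G.Adj v u := by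
  obtain ⟨u, hu, hne⟩ := Set.exists_ne_of_one_lt_ncard
    (show 1 < (G.connectedComponentMk v).supp.ncard from hcomp _) v
  obtain ⟨p⟩ := (ConnectedComponent.exact hu).symm
  cases p with
  | nil => exact absurd rfl hne
  | cons h q => exact ⟨_, h⟩

theorem exists_firstNeighbor (hadj : ∀ v, ∃ u, G.Adj v u) (π : V → ℕ) :
    ∃ m : V → V, (∀ w, G.Adj w (m w)) ∧ ∀ w u, G.Adj w u → π (m w) ≤ π u := by
  have h : ∀ w, ∃ u, G.Adj w u ∧ ∀ u', G.Adj w u' → π u ≤ π u' := by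
    intro w
    obtain ⟨u, hu, hmin⟩ := (InvImage.wf π Nat.lt_wfRel.wf).has_min {u | G.Adj w u} (hadj w)
    exact ⟨u, hu, fun u' hu' => not_lt.1 (hmin u' hu')⟩
  choose m hm using h
  exact ⟨m, fun w => (hm w).1, fun w => (hm w).2⟩

end SimpleGraph

/-! ### Counting the vertices missed by the first-neighbour map -/

namespace SimpleGraph

variable {V : Type*} (G : SimpleGraph V)

/-- For a vertex ordering in which the chosen root of each component is the only vertex without an
earlier neighbour, the vertices which are nobody's first neighbour are bounded in terms of the
cyclomatic number and the non-root pendant vertices. The vertex set `D` collects vertices of degree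
at least three that are incident to an edge outside the search forest. -/
theorem card_sdiff_image_firstNeighbor_le [Fintype V] [DecidableEq V] [DecidableRel G.Adj]
    (π : V → ℕ) (m : V → V) (hadj : ∀ w, G.Adj w (m w))
    (hmin : ∀ w u, G.Adj w u → π (m w) ≤ π u)
    (ρ : G.ConnectedComponent → V)
    (hroot : ∀ w, w ≠ ρ (G.connectedComponentMk w) → ∃ u, G.Adj u w ∧ π u < π w)
    (hπ : Function.Injective π) (D : Finset V)
    (hD : ∀ r ∈ D, 3 ≤ G.degree r ∧ ∃ z, G.Adj r z ∧ m r ≠ z ∧ m z ≠ r) :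
    (Finset.univ \ Finset.univ.image m).card + D.card +
        2 * (Finset.univ.filter fun v => v ≠ ρ (G.connectedComponentMk v)).card ≤
      2 * G.edgeFinset.card +
        (Finset.univ.filter fun v =>
          G.degree v = 1 ∧ v ≠ ρ (G.connectedComponentMk v)).card := by
  have hlt : ∀ w, w ≠ ρ (G.connectedComponentMk w) → π (m w) < π w := by
    intro w hw
    obtain ⟨u, hu, huw⟩ := hroot w hw
    exact (hmin w u hu.symm).trans_lt huw
  have hmk : ∀ {u v}, G.Adj u v → G.connectedComponentMk u = G.connectedComponentMk v :=
    fun h => ConnectedComponent.sound h.reachable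
  -- Iterating `m` from a non-root goes strictly down inside its component until it hits the root.
  have hrootmin : ∀ w, π (ρ (G.connectedComponentMk w)) ≤ π w := by
    intro w
    induction hk : π w using Nat.strong_induction_on generalizing w with
    | _ k ih =>
      by_cases hw : w = ρ (G.connectedComponentMk w)
      · rw [← hw, hk]
      · have := ih (π (m w)) (hk ▸ hlt w hw) (m w) rfl
        rw [← hmk (hadj w)] at this
        exact this.trans (hk ▸ (hlt w hw).le)
  -- A root is the first neighbour of each of its neighbours, being earliest in its component.
  have hrootimg : ∀ v, v ∉ Finset.univ.image m → v ≠ ρ (G.connectedComponentMk v) := by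
    intro v hv hvr
    apply hv
    refine Finset.mem_image.2 ⟨m v, Finset.mem_univ _, hπ (le_antisymm (hmin _ _ (hadj v).symm) ?_)⟩
    have := hrootmin (m (m v))
    rwa [← hmk (hadj (m v)), ← hmk (hadj v), ← hvr] at this
  let N : Finset V := Finset.univ.filter fun v => v ≠ ρ (G.connectedComponentMk v)
  -- Parent and children in the search forest; together they give the forest degree.
  let up : V → Finset V := fun v => if v ∈ N then {m v} else ∅
  let down : V → Finset V := fun v => N.filter fun w => m w = v
  have hN : ∀ v, v ∈ N ↔ v ≠ ρ (G.connectedComponentMk v) := fun v => by simp [N]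
  have hup_mem : ∀ v w, w ∈ up v → v ∈ N ∧ m v = w := by
    intro v w h
    by_cases hv : v ∈ N
    · simp only [up, if_pos hv, Finset.mem_singleton] at h
      exact ⟨hv, h.symm⟩
    · simp [up, if_neg hv] at h
  have hdisj : ∀ v, Disjoint (up v) (down v) := by
    intro v
    rw [Finset.disjoint_left]
    intro w hw hw'
    obtain ⟨hv, rfl⟩ := hup_mem v w hw
    obtain ⟨hw, hmw⟩ := Finset.mem_filter.1 hw'
    have h₁ := hlt v ((hN _).1 hv)
    have h₂ := hlt _ ((hN _).1 hw)
    rw [hmw] at h₂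
    omega
  have hsub : ∀ v, up v ∪ down v ⊆ G.neighborFinset v := by
    intro v w hw
    rw [mem_neighborFinset]
    rcases Finset.mem_union.1 hw with hw | hw
    · obtain ⟨-, rfl⟩ := hup_mem v w hw
      exact hadj v
    · obtain ⟨-, rfl⟩ := Finset.mem_filter.1 hw
      exact (hadj w).symm
  have hdeg : ∀ v, (up v).card + (down v).card ≤ G.degree v := by
    intro v
    rw [← Finset.card_union_of_disjoint (hdisj v), ← card_neighborFinset_eq_degree]
    exact Finset.card_le_card (hsub v)
  have hdegD : ∀ v ∈ D, (up v).card + (down v).card < G.degree v := by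
    intro v hv
    obtain ⟨-, z, hz, h₁, h₂⟩ := hD v hv
    rw [← Finset.card_union_of_disjoint (hdisj v), ← card_neighborFinset_eq_degree]
    refine Finset.card_lt_card (Finset.ssubset_iff_subset_ne.2 ⟨hsub v, fun h => ?_⟩)
    have hz' : z ∈ up v ∪ down v := h ▸ (mem_neighborFinset _ _ _).2 hz
    rcases Finset.mem_union.1 hz' with hw | hw
    · exact h₁ (hup_mem v z hw).2
    · exact h₂ (Finset.mem_filter.1 hw).2
  -- Local form of the bound. Off the image the forest degree is exactly 1, so degree at least three
  -- pays for both indicators; on the image, the non-forest edge pays for membership in `D`.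
  have hpoint : ∀ v, (if v ∈ Finset.univ \ Finset.univ.image m then 1 else 0) +
      (if v ∈ D then 1 else 0) + ((up v).card + (down v).card) ≤
      G.degree v + if G.degree v = 1 ∧ v ≠ ρ (G.connectedComponentMk v) then 1 else 0 := by
    intro v
    by_cases hv : v ∈ Finset.univ.image m
    · rw [if_neg (by simpa using hv)]
      by_cases hvD : v ∈ D
      · have := hdegD v hvD
        rw [if_pos hvD]
        omega
      · have := hdeg v
        rw [if_neg hvD]
        omega
    · have hvr := hrootimg v hv
      have hdown : (down v).card = 0 := by
        rw [Finset.card_eq_zero, Finset.filter_eq_empty_iff]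
        exact fun w _ hw => hv (Finset.mem_image.2 ⟨w, Finset.mem_univ _, hw⟩)
      have hup : (up v).card = 1 := by
        simp only [up, if_pos ((hN v).2 hvr), Finset.card_singleton]
      rw [if_pos (by simpa using hv), hdown, hup]
      have hpos : 0 < G.degree v := (G.degree_pos_iff_exists_adj v).2 ⟨_, hadj v⟩
      by_cases hvD : v ∈ D
      · have := (hD v hvD).1
        rw [if_pos hvD]
        omega
      · rw [if_neg hvD]
        by_cases h1 : G.degree v = 1
        · rw [if_pos ⟨h1, hvr⟩]
          omega
        · omega
  have hsum := Finset.sum_le_sum fun v (_ : v ∈ Finset.univ) => hpoint v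
  have hupsum : ∑ v, (up v).card = N.card := by
    have h : ∀ v, (up v).card = if v ∈ N then 1 else 0 := by
      intro v
      by_cases hv : v ∈ N <;> simp [up, hv]
    simp [h]
  have hdownsum : ∑ v, (down v).card = N.card :=
    (Finset.card_eq_sum_card_fiberwise fun v _ => Finset.mem_univ (m v)).symm
  simp only [Finset.sum_add_distrib, hupsum, hdownsum, G.sum_degrees_eq_twice_card_edges,
    Finset.sum_boole, Finset.filter_mem_eq_inter, Finset.univ_inter, Nat.cast_id] at hsum
  change _ + _ + 2 * N.card ≤ _
  omega

/-- The search forest has one edge per non-root, so this turns the edge count into the cyclomatic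
number. -/
theorem card_filter_ne_root [Fintype V] [DecidableEq V] (ρ : G.ConnectedComponent → V)
    (hρ : ∀ K, G.connectedComponentMk (ρ K) = K) :
    (Finset.univ.filter fun v => v ≠ ρ (G.connectedComponentMk v)).card +
      Nat.card G.ConnectedComponent = Fintype.card V := by
  classical
  have : Fintype G.ConnectedComponent := Fintype.ofFinite _
  have hinj : Function.Injective ρ := fun K K' h => by rw [← hρ K, h, hρ]
  rw [Nat.card_eq_fintype_card, ← Finset.card_univ, ← Finset.card_image_of_injective _ hinj,
    ← Finset.card_univ, ← Finset.card_filter_add_card_filter_not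
      (s := (Finset.univ : Finset V)) (fun v => v ≠ ρ (G.connectedComponentMk v))]
  congr 2
  ext v
  simp only [Finset.mem_image, Finset.mem_univ, true_and, Finset.mem_filter, not_not]
  constructor
  · rintro ⟨K, rfl⟩
    rw [hρ]
  · exact fun h => ⟨_, h.symm⟩

end SimpleGraph

/-! ### Intersecting cycles and search orders -/

namespace SimpleGraph

variable {V : Type*} (G : SimpleGraph V)

theorem IsCycleSubgraph.adj_of_ncard_le_two [Finite V] {G : SimpleGraph V} {C : G.Subgraph}
    (hC : IsCycleSubgraph C) {u w : V} (hu : u ∈ C.verts) (hle : (G.neighborSet u).ncard ≤ 2)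
    (h : G.Adj u w) : C.Adj u w := by
  obtain ⟨v, p, hp, rfl⟩ := hC
  have h2 := hp.ncard_neighborSet_toSubgraph_eq_two (p.mem_verts_toSubgraph.1 hu)
  have heq : p.toSubgraph.neighborSet u = G.neighborSet u :=
    Set.eq_of_subset_of_ncard_le (p.toSubgraph.neighborSet_subset u) (by omega) (Set.toFinite _)
  have hw : w ∈ p.toSubgraph.neighborSet u := heq ▸ h
  exact hw

/-- A cycle uses two edges at each vertex; if there are no others, walks cannot leave it. -/
theorem IsCycleSubgraph.le_of_ncard_le_two [Finite V] {G : SimpleGraph V} {C D : G.Subgraph}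
    (hC : IsCycleSubgraph C) (hD : IsCycleSubgraph D) {v : V} (hvC : v ∈ C.verts)
    (hvD : v ∈ D.verts) (hle : ∀ u ∈ C.verts, (G.neighborSet u).ncard ≤ 2) : D ≤ C := by
  classical
  have hwalk : ∀ {a b : V} (q : G.Walk a b), a ∈ C.verts → b ∈ C.verts := by
    intro a b q
    induction q with
    | nil => exact id
    | cons h _ ih => exact fun ha => ih (hC.adj_of_ncard_le_two ha (hle _ ha) h).snd_mem
  have hverts : D.verts ⊆ C.verts := by
    obtain ⟨x, p, hp, rfl⟩ := hD
    intro u hu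
    rw [Walk.mem_verts_toSubgraph] at hu hvD
    exact hwalk (p.takeUntil u hu) (hwalk (p.takeUntil v hvD).reverse hvC)
  exact ⟨hverts, fun u w h =>
    hC.adj_of_ncard_le_two (hverts h.fst_mem) (hle _ (hverts h.fst_mem)) h.adj_sub⟩

theorem IsCycleSubgraph.exists_three_le_ncard [Finite V] {G : SimpleGraph V} {C D : G.Subgraph}
    (hC : IsCycleSubgraph C) (hD : IsCycleSubgraph D) (hne : C ≠ D)
    (h : (C.verts ∩ D.verts).Nonempty) : ∃ r ∈ C.verts, 3 ≤ (G.neighborSet r).ncard := by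
  by_contra! hcon
  obtain ⟨v, hvC, hvD⟩ := h
  have hDC := hC.le_of_ncard_le_two hD hvC hvD fun u hu => by have := hcon u hu; omega
  have hCD := hD.le_of_ncard_le_two hC hvD hvC fun u hu => by
    have := hcon u (hDC.1 hu)
    omega
  exact hne (le_antisymm hCD hDC)

/-- Cutting the cycle at `r` leaves a path between its two cycle-neighbours that avoids `r`. -/
theorem IsCycleSubgraph.exists_reachable_deleteIncidenceSet {G : SimpleGraph V} {C : G.Subgraph}
    (hC : IsCycleSubgraph C) {r : V} (hr : r ∈ C.verts) :
    ∃ z z', G.Adj r z ∧ G.Adj r z' ∧ z ≠ z' ∧ (G.deleteIncidenceSet r).Reachable z z' := by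
  classical
  obtain ⟨v, p, hp, rfl⟩ := hC
  rw [Walk.mem_verts_toSubgraph] at hr
  have hc := hp.rotate hr
  generalize p.rotate r hr = c at hc
  cases c with
  | nil => exact absurd rfl hc.ne_nil
  | @cons _ z _ h q =>
    rw [Walk.cons_isCycle_iff] at hc
    obtain ⟨hq, hedge⟩ := hc
    have hqr := hq.reverse
    rw [← List.mem_reverse, ← Walk.edges_reverse] at hedge
    generalize q.reverse = q' at hqr hedge
    cases q' with
    | nil => exact absurd rfl h.ne
    | @cons _ z' _ h' t =>
      rw [Walk.cons_isPath_iff] at hqr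
      refine ⟨z, z', h, h', ?_, ?_⟩
      · rintro rfl
        simp at hedge
      · refine (Walk.reachable (Walk.transfer t _ ?_)).symm
        intro e he
        induction e with
        | _ x y =>
          rw [mem_edgeSet, deleteIncidenceSet_adj]
          refine ⟨t.adj_of_mem_edges he, ?_, ?_⟩
          · rintro rfl
            exact hqr.2 (t.fst_mem_support_of_mem_edges he)
          · rintro rfl
            exact hqr.2 (t.snd_mem_support_of_mem_edges he)

theorem Reachable.dist_lt_card [Fintype V] {G : SimpleGraph V} {a b : V} (h : G.Reachable a b) :
    G.dist a b < Fintype.card V := by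
  classical
  obtain ⟨p⟩ := h
  exact (dist_le p.bypass).trans_lt p.bypass_isPath.length_lt

/-- Ordering by distance from the root works: a shortest path supplies the earlier neighbour. -/
theorem exists_search_order [Fintype V] (v₀ : V) :
    ∃ (ρ : G.ConnectedComponent → V) (π : V → ℕ), Function.Injective π ∧
      (∀ K, G.connectedComponentMk (ρ K) = K) ∧ ρ (G.connectedComponentMk v₀) = v₀ ∧
      ∀ w, w ≠ ρ (G.connectedComponentMk w) → ∃ u, G.Adj u w ∧ π u < π w := by
  obtain ⟨ρ, hρ, hv₀⟩ := G.exists_root_through v₀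
  obtain ⟨π, hinj, hπ⟩ :=
    exists_injective_refining fun w => G.dist (ρ (G.connectedComponentMk w)) w
  refine ⟨ρ, π, hinj, hρ, hv₀, fun w hw => ?_⟩
  obtain ⟨u, hu, -, hlt⟩ := (ConnectedComponent.exact (hρ _)).exists_adj_dist_lt hw
  refine ⟨u, hu, hπ _ _ ?_⟩
  rwa [ConnectedComponent.sound hu.reachable]

/-- If two neighbours of `r` are connected outside `r`, then there is a search order in which the
edge from `r` to the second one is not in the search forest. -/
theorem exists_search_order_avoiding [Fintype V] {r z z' : V} (hz : G.Adj r z)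
    (hne : z ≠ z') (hreach : (G.deleteIncidenceSet r).Reachable z z') :
    ∃ (ρ : G.ConnectedComponent → V) (π : V → ℕ), Function.Injective π ∧
      (∀ K, G.connectedComponentMk (ρ K) = K) ∧
      (∀ w, w ≠ ρ (G.connectedComponentMk w) → ∃ u, G.Adj u w ∧ π u < π w) ∧
      ∀ m : V → V, (∀ w u, G.Adj w u → π (m w) ≤ π u) → m r ≠ z' ∧ m z' ≠ r := by
  classical
  obtain ⟨ρ, hρ, hz₀⟩ := G.exists_root_through z
  let H := G.deleteIncidenceSet r
  have hHG : ∀ {u v}, H.Adj u v → G.Adj u v := fun h => (deleteIncidenceSet_adj.1 h).1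
  -- The component of `z` in `G` minus `r` comes first, by distance from `z` there; the shift by
  -- `card V` exceeds all those distances, so every other vertex, `r` included, comes later.
  let key : V → ℕ := fun w =>
    if H.Reachable z w then H.dist z w
    else Fintype.card V + G.dist (ρ (G.connectedComponentMk w)) w
  have hkey₁ : ∀ w, H.Reachable z w → key w = H.dist z w := fun w h => if_pos h
  have hkey₂ : ∀ w, ¬ H.Reachable z w →
      key w = Fintype.card V + G.dist (ρ (G.connectedComponentMk w)) w := fun w h => if_neg h
  have hclose : ∀ w, H.Reachable z w → w ≠ z → ∃ u, G.Adj u w ∧ H.Reachable z u ∧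
      key u < key w := by
    intro w hw hwz
    obtain ⟨u, hu, hzu, hlt⟩ := hw.exists_adj_dist_lt hwz
    exact ⟨u, hHG hu, hzu, by rwa [hkey₁ u hzu, hkey₁ w hw]⟩
  have hrz : ¬ H.Reachable z r := by
    intro h
    obtain ⟨u, hu, -⟩ := h.exists_adj_dist_lt hz.ne
    exact (deleteIncidenceSet_adj.1 hu).2.2 rfl
  obtain ⟨π, hinj, hπ⟩ := exists_injective_refining key
  refine ⟨ρ, π, hinj, hρ, fun w hw => ?_, fun m hm => ⟨?_, ?_⟩⟩
  · by_cases hzw : H.Reachable z w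
    · have hwz : w ≠ z := by
        rintro rfl
        exact hw hz₀.symm
      obtain ⟨u, hu, -, hlt⟩ := hclose w hzw hwz
      exact ⟨u, hu, hπ _ _ hlt⟩
    · obtain ⟨u, hu, -, hlt⟩ := (ConnectedComponent.exact (hρ _)).exists_adj_dist_lt hw
      refine ⟨u, hu, hπ _ _ ?_⟩
      rw [hkey₂ w hzw]
      by_cases hzu : H.Reachable z u
      · rw [hkey₁ u hzu]
        have := hzu.dist_lt_card
        omega
      · rw [hkey₂ u hzu, ConnectedComponent.sound hu.reachable]
        omega
  -- `z` is a neighbour of `r` earlier than `z'`.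
  · rintro hmr
    have hlt : key z < key z' := by
      rw [hkey₁ z (Reachable.refl z), hkey₁ z' hreach, dist_self]
      exact hreach.pos_dist_of_ne hne
    have h₁ := hm r z hz
    have h₂ := hπ _ _ hlt
    rw [hmr] at h₁
    omega
  -- `z'` has a neighbour closer to `z` outside `r`, hence earlier than `r`.
  · intro hmz
    obtain ⟨u, hu, hzu, -⟩ := hclose z' hreach hne.symm
    have hlt : key u < key r := by
      rw [hkey₁ u hzu, hkey₂ r hrz]
      have := hzu.dist_lt_card
      omega
    have h₁ := hm z' u hu.symm
    have h₂ := hπ _ _ hlt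
    rw [hmz] at h₁
    omega

end SimpleGraph

/-! ### From search orders to the rank bounds -/

namespace QuaternionUnitGainGraph

/-- A rank bound read off from a search order: `D` collects vertices of degree at least three that
are incident to an edge outside the search forest. -/
theorem le_rank_of_search_order {V : Type*} [Fintype V] [DecidableEq V]
    (Γ : QuaternionUnitGainGraph V) [DecidableRel Γ.graph.Adj]
    (π : V → ℕ) (hπ : Function.Injective π)
    (m : V → V) (hadj : ∀ w, Γ.graph.Adj w (m w))
    (hmin : ∀ w u, Γ.graph.Adj w u → π (m w) ≤ π u)
    (ρ : Γ.graph.ConnectedComponent → V) (hρ : ∀ K, Γ.graph.connectedComponentMk (ρ K) = K)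
    (hroot : ∀ w, w ≠ ρ (Γ.graph.connectedComponentMk w) → ∃ u, Γ.graph.Adj u w ∧ π u < π w)
    (D : Finset V)
    (hD : ∀ r ∈ D, 3 ≤ Γ.graph.degree r ∧ ∃ z, Γ.graph.Adj r z ∧ m r ≠ z ∧ m z ≠ r) :
    (Fintype.card V : ℤ) - 2 * Γ.cyclomaticNumber + D.card ≤
      Γ.rank + (Finset.univ.filter fun v => Γ.graph.degree v = 1 ∧
        v ≠ ρ (Γ.graph.connectedComponentMk v)).card := by
  have h₁ := Γ.graph.card_sdiff_image_firstNeighbor_le π m hadj hmin ρ hroot hπ D hD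
  have h₂ := Γ.graph.card_filter_ne_root ρ hρ
  have h₃ := Γ.card_image_firstNeighbor_le_rank π hπ m hadj hmin
  have h₄ := Finset.card_sdiff_add_card_eq_card (Finset.subset_univ (Finset.univ.image m))
  have h₅ : Γ.graph.edgeSet.ncard = Γ.graph.edgeFinset.card := by
    rw [← SimpleGraph.coe_edgeFinset, Set.ncard_coe_finset]
  rw [Finset.card_univ] at h₄
  unfold cyclomaticNumber
  rw [Nat.card_eq_fintype_card, h₅]
  omega

theorem pendantNumber_eq_card {V : Type*} [Fintype V] (Γ : QuaternionUnitGainGraph V)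
    [DecidableRel Γ.graph.Adj] :
    Γ.pendantNumber = (Finset.univ.filter fun v => Γ.graph.degree v = 1).card := by
  rw [pendantNumber, ← Set.ncard_coe_finset]
  congr 1
  ext v
  simp [← SimpleGraph.card_neighborSet_eq_degree, Set.ncard_eq_toFinset_card']

end QuaternionUnitGainGraph

theorem mainTheorem1 {V : Type*} [Fintype V] (Γ : QuaternionUnitGainGraph V) (n : ℕ)
    (hn : Fintype.card V = n)
    (hcomp : ∀ K : Γ.graph.ConnectedComponent, 2 ≤ K.supp.ncard) :
    (1 ≤ Γ.pendantNumber →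
      (n : ℤ) - 2 * Γ.cyclomaticNumber - (Γ.pendantNumber : ℤ) + 1 ≤ (Γ.rank : ℤ)) ∧
    (Γ.pendantNumber = 0 → Γ.graph.CycleDisjoint →
      (n : ℤ) - 2 * Γ.cyclomaticNumber ≤ (Γ.rank : ℤ)) ∧
    (Γ.pendantNumber = 0 → Γ.graph.HasCyclesWithCommonVertex →
      (n : ℤ) - 2 * Γ.cyclomaticNumber + 1 ≤ (Γ.rank : ℤ)) := by
  classical
  subst hn
  have hnbr := Γ.graph.exists_adj_of_two_le_ncard_supp hcomp
  have hpend := Γ.pendantNumber_eq_card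
  have hle : ∀ ρ : Γ.graph.ConnectedComponent → V,
      (Finset.univ.filter fun v => Γ.graph.degree v = 1 ∧
        v ≠ ρ (Γ.graph.connectedComponentMk v)).card ≤ Γ.pendantNumber := fun ρ =>
    hpend ▸ Finset.card_le_card (Finset.monotone_filter_right _ fun v _ h => h.1)
  refine ⟨fun hp => ?_, fun hp _ => ?_, fun hp hcyc => ?_⟩
  -- Rooting at a pendant vertex `v₀` removes it from the non-root pendants, which gains the `1`.
  · obtain ⟨v₀, hv₀⟩ := Finset.card_pos.1 (hpend ▸ hp)
    obtain ⟨ρ, π, hπ, hρ, hρv₀, hroot⟩ := Γ.graph.exists_search_order v₀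
    obtain ⟨m, hadj, hmin⟩ := Γ.graph.exists_firstNeighbor hnbr π
    have h := Γ.le_rank_of_search_order π hπ m hadj hmin ρ hρ hroot ∅ (by simp)
    have hlt : (Finset.univ.filter fun v => Γ.graph.degree v = 1 ∧
        v ≠ ρ (Γ.graph.connectedComponentMk v)).card < Γ.pendantNumber := by
      rw [hpend]
      refine Finset.card_lt_card (Finset.ssubset_iff_subset_ne.2
        ⟨Finset.monotone_filter_right _ fun v _ h => h.1, fun heq => ?_⟩)
      rw [← heq, Finset.mem_filter] at hv₀
      exact hv₀.2.2 hρv₀.symm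
    rw [Finset.card_empty] at h
    omega
  -- The empty graph is allowed and has no vertex to root at.
  · rcases isEmpty_or_nonempty V with hV | ⟨⟨v₀⟩⟩
    · have h₁ : Γ.graph.edgeSet.ncard = 0 := by
        rw [Set.ncard_eq_zero]
        exact Set.eq_empty_of_forall_notMem fun e _ => by
          induction e with
          | _ x y => exact hV.elim x
      have h₂ : IsEmpty Γ.graph.ConnectedComponent := ⟨fun K => hV.elim K.out⟩
      simp [QuaternionUnitGainGraph.cyclomaticNumber, h₁]
    · obtain ⟨ρ, π, hπ, hρ, -, hroot⟩ := Γ.graph.exists_search_order v₀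
      obtain ⟨m, hadj, hmin⟩ := Γ.graph.exists_firstNeighbor hnbr π
      have h := Γ.le_rank_of_search_order π hπ m hadj hmin ρ hρ hroot ∅ (by simp)
      have := hle ρ
      rw [Finset.card_empty] at h
      omega
  · obtain ⟨C, D, hC, hD, hne, hCD⟩ := hcyc
    obtain ⟨r, hr, hr3⟩ := hC.exists_three_le_ncard hD hne hCD
    obtain ⟨z, z', hz, hz', hzz', hreach⟩ := hC.exists_reachable_deleteIncidenceSet hr
    obtain ⟨ρ, π, hπ, hρ, hroot, havoid⟩ :=
      Γ.graph.exists_search_order_avoiding hz hzz' hreach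
    obtain ⟨m, hadj, hmin⟩ := Γ.graph.exists_firstNeighbor hnbr π
    -- The non-forest edge from `r` to `z'` qualifies `r` for `D`, which gains the `1`.
    have h := Γ.le_rank_of_search_order π hπ m hadj hmin ρ hρ hroot {r} (by
      intro x hx
      rw [Finset.mem_singleton] at hx
      subst hx
      refine ⟨?_, z', hz', havoid m hmin⟩
      rwa [← SimpleGraph.card_neighborSet_eq_degree, ← Nat.card_eq_fintype_card])
    have := hle ρ
    rw [Finset.card_singleton] at h
    push_cast at h
    omega
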